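/- **Setting.** All Hilbert spaces are complex. Let $N\ge 2$, let $K$ be a Hilbert space, and let $V_0,\dots,V_{N-1}$ be bounded operators on $K$ with $\sum_{i}V_iV_i^*=I_K$. Let $(H,S_i)_{i=0}^{N-1}$ be the Cuntz dilation of $(K,V_i)$: $H\supseteq K$ is a Hilbert space, the bounded operators $S_i$ on $H$ satisfy $S_i^*S_j=\delta_{ij}I$ and $\sum_i S_iS_i^*=I$, $S_i^*K\subseteq K$ and $S_i^*|_K=V_i^*$ for all $i$, and $K$ is cyclic for the representation generated by the $S_i$ (the only closed subspace of $H$ that contains $K$ and is invariant under all $S_i$ and $S_i^*$ is $H$). Let $K_0\subseteq K$ be a closed subspace with $V_i^*K_0\subseteq K_0$ for all $i$, with an orthonormal basis $(e_c)_{c\in M}$, $M$ finite and nonempty, and let $\nu_i:M\to\mathbb C$, $g_i:M\to M$ be maps with $V_i^*e_c=\nu_i(c)e_{g_i(c)}$ for all $i$ and $c$, such that $\nu_i(c_1)\ne0$, $\nu_i(c_2)\neq 0$ and $g_i(c_1)=g_i(c_2)$ imply $c_1=c_2$. For a finite word $\omega=\omega_1\dots\omega_n$ over $\{0,\dots,N-1\}$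 (possibly empty) put $S_\omega=S_{\omega_1}\cdots S_{\omega_n}$, $g_\omega=g_{\omega_n}\circ\dots\circ g_{\omega_1}$ and $\nu_\omega(c)=\nu_{\omega_1}(c)\,\nu_{\omega_2}(g_{\omega_1}(c))\cdots\nu_{\omega_n}(g_{\omega_1\dots\omega_{n-1}}(c))$; for the empty word these are $I$, the identity and $1$. Assume that the walk is irreducible (for all $c_1,c_2\in M$ there is a word $\omega$ with $g_\omega(c_1)=c_2$ and $\nu_\omega(c_1)\ne0$), and that $\{V_i\}$ is simple on $K_0$ (the only operators $T$ on $K_0$ with $P_{K_0}\big(\sum_iV_iTV_i^*\big)P_{K_0}=T$ are the scalar multiples of $I_{K_0}$). A *cycle word* for $c\in M$ is a nonempty word $\beta$ with $g_\beta(c)=c$, $\nu_\beta(c)\neq0$, and $g_\gamma(c)\ne c$ for every nonempty proper prefix $\gamma$ of $\beta$. A *loop* for $c$ is a word $\gamma$ that is empty or satisfies $g_\gamma(c)=c$ and $\nu_\gamma(c)\ne0$. Let $\Omega_c^{(0)}$ be the set of words that do not end in a cycle word for $c$; for $n\ge1$ let $\Omega_c^{(n)}$ be the set of words $\omega_0\beta_1\dots\beta_n$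 with $\omega_0\in\Omega_c^{(0)}$ and $\beta_1,\dots,\beta_n$ cycle words for $c$. Let $V^{(c)}=\overline{\operatorname{span}}\{S_\omega e_c:\omega \text{ any word}\}$. **Proposition.** (1) Suppose that $|\nu_i(c)|\in\{0,1\}$ for all $c\in M$ and all $i$. Then: - $M$ is a single cycle: its elements can be listed without repetition as $x_0,\dots,x_{p-1}$ so that, for each $k$, there is exactly one $i$ with $\nu_i(x_k)\ne0$, and for this $i$ one has $g_i(x_k)=x_{k+1}$ (indices mod $p$); - $\{V_i\}$ is reversing: $V_ie_{g_i(c)}=\overline{\nu_i(c)}\,e_c$ whenever $\nu_i(c)\neq0$; - for all $c\in M$ and $n\ge0$ and every $\omega=\omega_0\gamma\in\Omega_c^{(n)}$ with $\omega_0\in\Omega_c^{(0)}$ and $\gamma$ a loop for $c$, the vector $S_\omega e_c$ is a unimodular constant multiple of $S_{\omega_0}e_c$; - for every $c\in M$, the family $(S_\omega e_c)_{\omega\in\Omega_c^{(0)}}$ is an orthonormal basis of $V^{(c)}$. (2) If $c\in M$ and $\nu_i(c)\ne0$ for at least two distinct $i$, then for every $n\ge0$ the family $\{S_\omega e_c:\omega\in\Omega_c^{(n)}\}$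 is incomplete in $V^{(c)}$, that is, $\overline{\operatorname{span}}\{S_\omega e_c:\omega\in\Omega_c^{(n)}\}\ne V^{(c)}$. -/

import Mathlib

open scoped InnerProduct ComplexConjugate

namespace CuntzWalk

section Operators

/-- `(K, V_i)` is a row co-isometry: `N ≥ 2` and `∑ V_i V_i^* = I_K`. -/
structure IsRowCoisometry {N : ℕ} {K : Type*} [NormedAddCommGroup K] [InnerProductSpace ℂ K]
    [CompleteSpace K] (V : Fin N → K →L[ℂ] K) : Prop where
  two_le : 2 ≤ N
  sum_eq : ∑ i, V i ∘L (V i)† = ContinuousLinearMap.id ℂ K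

/-- `S_0, …, S_{N-1}` satisfy the Cuntz relations `S_i^* S_j = δ_{ij} I`, `∑ S_i S_i^* = I`. -/
structure IsCuntzFamily {N : ℕ} {H : Type*} [NormedAddCommGroup H] [InnerProductSpace ℂ H]
    [CompleteSpace H] (S : Fin N → H →L[ℂ] H) : Prop where
  isometry : ∀ i, (S i)† ∘L S i = ContinuousLinearMap.id ℂ H
  orthogonal : ∀ i j, i ≠ j → (S i)† ∘L S j = 0
  sum_eq : ∑ i, S i ∘L (S i)† = ContinuousLinearMap.id ℂ H

/-- `(H, S_i)` is the Cuntz dilation of `(K, V_i)`, where `K` is embedded into `H` by the linear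
isometry `ι`: the `S_i` satisfy the Cuntz relations, `K` is invariant under every `S_i^*` and `S_i^*`
restricts to `V_i^*` on `K` (so that, with `p` the projection onto `K`, also `p S_i = p S_i p` and
`V_i = p S_i` on `K`), and `K` is cyclic for the representation. -/
structure IsCuntzDilation {N : ℕ} {K H : Type*} [NormedAddCommGroup K] [InnerProductSpace ℂ K]
    [CompleteSpace K] [NormedAddCommGroup H] [InnerProductSpace ℂ H] [CompleteSpace H]
    (V : Fin N → K →L[ℂ] K) (ι : K →ₗᵢ[ℂ] H) (S : Fin N → H →L[ℂ] H) : Prop where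
  cuntz : IsCuntzFamily S
  adjoint_apply : ∀ i k, ((S i)†) (ι k) = ι (((V i)†) k)
  cyclic : ∀ W : Submodule ℂ H, IsClosed (W : Set H) → (∀ k, ι k ∈ W) →
    (∀ i, ∀ x ∈ W, S i x ∈ W) → (∀ i, ∀ x ∈ W, ((S i)†) x ∈ W) → W = ⊤

/-- `S_ω = S_{ω_1} ⋯ S_{ω_n}` for a word `ω = ω_1 … ω_n` (the identity for the empty word). -/
noncomputable def wordOp {N : ℕ} {H : Type*} [NormedAddCommGroup H] [InnerProductSpace ℂ H]
    (S : Fin N → H →L[ℂ] H) (ω : List (Fin N)) : H →L[ℂ] H :=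
  (ω.map S).prod

/-- The closed linear span of `{S_ω v : ω ∈ A}`. -/
noncomputable def wordSpan {N : ℕ} {H : Type*} [NormedAddCommGroup H] [InnerProductSpace ℂ H]
    (S : Fin N → H →L[ℂ] H) (v : H) (A : Set (List (Fin N))) : Submodule ℂ H :=
  (Submodule.span ℂ ((fun ω => wordOp S ω v) '' A)).topologicalClosure

end Operators

section Graph

/-- `g_ω = g_{ω_n} ∘ ⋯ ∘ g_{ω_1}` for `ω = ω_1 … ω_n`. -/
def wordMap {N : ℕ} {M : Type*} (g : Fin N → M → M) : List (Fin N) → M → M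
  | [], c => c
  | i :: ω, c => wordMap g ω (g i c)

/-- `ν_ω(c) = ν_{ω_1}(c) ν_{ω_2}(g_{ω_1}(c)) ⋯ ν_{ω_n}(g_{ω_1 … ω_{n-1}}(c))`. -/
def wordWeight {N : ℕ} {M : Type*} (g : Fin N → M → M) (ν : Fin N → M → ℂ) :
    List (Fin N) → M → ℂ
  | [], _ => 1
  | i :: ω, c => ν i c * wordWeight g ν ω (g i c)

/-- Every vertex can be reached from every vertex with positive probability. -/
def IsIrreducibleWalk {N : ℕ} {M : Type*} (g : Fin N → M → M) (ν : Fin N → M → ℂ) : Prop :=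
  ∀ c₁ c₂ : M, ∃ ω : List (Fin N), wordMap g ω c₁ = c₂ ∧ wordWeight g ν ω c₁ ≠ 0

/-- `β` is a cycle word for `c`: a nonempty word along which `c` returns to `c` with positive
probability, and not earlier than at the end of the word. -/
structure IsCycleWord {N : ℕ} {M : Type*} (g : Fin N → M → M) (ν : Fin N → M → ℂ) (c : M)
    (β : List (Fin N)) : Prop where
  ne_nil : β ≠ []
  returns : wordMap g β c = c
  first : ∀ γ : List (Fin N), γ <+: β → γ ≠ [] → γ ≠ β → wordMap g γ c ≠ c
  possible : wordWeight g ν β c ≠ 0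

/-- `β` is a loop for `c`: it is empty, or `c` returns to `c` along it with positive probability. -/
def IsLoop {N : ℕ} {M : Type*} (g : Fin N → M → M) (ν : Fin N → M → ℂ) (c : M)
    (β : List (Fin N)) : Prop :=
  β = [] ∨ (wordMap g β c = c ∧ wordWeight g ν β c ≠ 0)

/-- The words that do not end in a cycle word for `c`. -/
def wordsZero {N : ℕ} {M : Type*} (g : Fin N → M → M) (ν : Fin N → M → ℂ) (c : M) :
    Set (List (Fin N)) :=
  {ω | ∀ β, IsCycleWord g ν c β → ¬ β <:+ ω}

/-- The words `ω₀ β₁ … β_n` with `β₁, …, β_n` cycle words for `c` and `ω₀` not ending in a cycle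
word for `c`. -/
def wordsEnding {N : ℕ} {M : Type*} (g : Fin N → M → M) (ν : Fin N → M → ℂ) (c : M) (n : ℕ) :
    Set (List (Fin N)) :=
  {ω | ∃ ω₀ ∈ wordsZero g ν c, ∃ βs : List (List (Fin N)),
    βs.length = n ∧ (∀ β ∈ βs, IsCycleWord g ν c β) ∧ ω = ω₀ ++ βs.flatten}

theorem wordsEnding_zero {N : ℕ} {M : Type*} (g : Fin N → M → M) (ν : Fin N → M → ℂ) (c : M) :
    wordsEnding g ν c 0 = wordsZero g ν c := by
  ext ω
  constructor
  · rintro ⟨ω₀, h₀, βs, hlen, -, rfl⟩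
    obtain rfl := List.length_eq_zero_iff.mp hlen
    simpa using h₀
  · intro h
    exact ⟨ω, h, [], rfl, by simp, by simp⟩

/-- The graph of possible transitions is a single cycle: the vertices can be listed cyclically
without repetition as `x_0, …, x_{p-1}`, `p ≥ 1`, so that from each `x_k` exactly one edge is
possible, and it leads to `x_{k+1}` (indices mod `p`). -/
def IsSingleCycle {N : ℕ} {M : Type*} (g : Fin N → M → M) (ν : Fin N → M → ℂ) : Prop :=
  ∃ p : ℕ, 0 < p ∧ ∃ (x : ZMod p ≃ M) (d : ZMod p → Fin N),
    ∀ k, (∀ i, ν i (x k) ≠ 0 ↔ i = d k) ∧ g (d k) (x k) = x (k + 1)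

end Graph

section Walk

/-- `(V_i)` acts on `K₀`, with orthonormal basis `(e_c)`, as a random walk on the graph
`(M, {g_i}, {ν_i})`. -/
structure ActsAsRandomWalk {N : ℕ} {K M : Type*} [NormedAddCommGroup K] [InnerProductSpace ℂ K]
    [CompleteSpace K] [Fintype M] (V : Fin N → K →L[ℂ] K) (K₀ : Submodule ℂ K)
    (e : OrthonormalBasis M ℂ K₀) (g : Fin N → M → M) (ν : Fin N → M → ℂ) : Prop where
  invariant : ∀ i, ∀ x ∈ K₀, ((V i)†) x ∈ K₀
  adjoint_apply : ∀ i c, ((V i)†) (e c : K) = ν i c • (e (g i c) : K)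
  injective : ∀ i c₁ c₂, ν i c₁ ≠ 0 → ν i c₂ ≠ 0 → g i c₁ = g i c₂ → c₁ = c₂

/-- `(V_i)` is simple on `K₀`: the only operators `T` on `K₀` with
`P_{K₀} (∑ V_i T V_i^*) P_{K₀} = T` are the scalars. Here `T` is viewed on `K` as `T P_{K₀}`. -/
def IsSimpleOn {N : ℕ} {K : Type*} [NormedAddCommGroup K] [InnerProductSpace ℂ K]
    [CompleteSpace K] (V : Fin N → K →L[ℂ] K) (K₀ : Submodule ℂ K) [CompleteSpace K₀] : Prop :=
  ∀ T : K₀ →L[ℂ] K₀,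
    K₀.orthogonalProjectionOnto ∘L
      (∑ i, V i ∘L (K₀.subtypeL ∘L T ∘L K₀.orthogonalProjectionOnto) ∘L (V i)†) ∘L K₀.subtypeL = T →
    ∃ z : ℂ, T = z • ContinuousLinearMap.id ℂ K₀

/-- `(V_i)` is reversing on the random walk. -/
def IsReversing {N : ℕ} {K M : Type*} [NormedAddCommGroup K] [InnerProductSpace ℂ K]
    [Fintype M] (V : Fin N → K →L[ℂ] K) {K₀ : Submodule ℂ K}
    (e : OrthonormalBasis M ℂ K₀) (g : Fin N → M → M) (ν : Fin N → M → ℂ) : Prop :=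
  ∀ i c, ν i c ≠ 0 → V i (e (g i c) : K) = conj (ν i c) • (e c : K)

end Walk

end CuntzWalk

/-! Everything rests on the inner products of the vectors `S_ω e_c`. Common prefixes cancel by the
Cuntz relations, and `S_i^*` moves the basis along the walk. So the product vanishes unless one word
extends the other by a loop `τ`, and then it is `ν_τ(c)` up to conjugation
(`exists_loop_of_inner_ne_zero`, `inner_wordOp_of_isLoop`). Loops are concatenations of cycle words,
and by injectivity along edges these form a suffix code, so the number of trailing cycle words of a
word is well defined (`wordsEnding_level_unique`).

(1) As `∑ |ν_i(c)|² = 1`, moduli 0 and 1 leave one edge per vertex, and irreducibility makes the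
resulting map a transitive permutation. Loop weights are unimodular, so equality in Cauchy–Schwarz
gives `S_γ e_c = conj ν_γ(c) e_c`: loops are absorbed into scalars.

(2) With two edges at `c`, a cycle word `β` has `|ν_β(c)| < 1`. The component of `S_β e_c`
orthogonal to `e_c` is then nonzero, and its image under `S_β ^ n` is orthogonal to all words of
level `n` (`wordSpan_wordsEnding_ne`). -/

namespace CuntzWalk

/-! ### Combinatorics of loops and cycle words -/

section Words

variable {N : ℕ} {M : Type*} {g : Fin N → M → M} {ν : Fin N → M → ℂ} {c : M}

theorem wordMap_append (a b : List (Fin N)) (c : M) :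
    wordMap g (a ++ b) c = wordMap g b (wordMap g a c) := by
  induction a generalizing c with
  | nil => rfl
  | cons i a ih => exact ih _

theorem wordWeight_append (a b : List (Fin N)) (c : M) :
    wordWeight g ν (a ++ b) c = wordWeight g ν a c * wordWeight g ν b (wordMap g a c) := by
  induction a generalizing c with
  | nil => simp [wordWeight, wordMap]
  | cons i a ih => simp [wordWeight, wordMap, ih, mul_assoc]

/-- Along a fixed word, paths of positive probability with the same end have the same start. -/
theorem wordMap_injective
    (hinj : ∀ i c₁ c₂, ν i c₁ ≠ 0 → ν i c₂ ≠ 0 → g i c₁ = g i c₂ → c₁ = c₂)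
    (a : List (Fin N)) {c₁ c₂ : M} (h₁ : wordWeight g ν a c₁ ≠ 0) (h₂ : wordWeight g ν a c₂ ≠ 0)
    (h : wordMap g a c₁ = wordMap g a c₂) : c₁ = c₂ := by
  induction a generalizing c₁ c₂ with
  | nil => exact h
  | cons i a ih =>
    simp only [wordWeight, mul_ne_zero_iff] at h₁ h₂
    exact hinj i _ _ h₁.1 h₂.1 (ih h₁.2 h₂.2 h)

theorem IsLoop.wordMap_eq {τ : List (Fin N)} (h : IsLoop g ν c τ) : wordMap g τ c = c := by
  rcases h with rfl | h
  · rfl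
  · exact h.1

theorem IsLoop.wordWeight_ne_zero {τ : List (Fin N)} (h : IsLoop g ν c τ) :
    wordWeight g ν τ c ≠ 0 := by
  rcases h with rfl | h
  · simp [wordWeight]
  · exact h.2

theorem IsCycleWord.isLoop {β : List (Fin N)} (h : IsCycleWord g ν c β) : IsLoop g ν c β :=
  Or.inr ⟨h.returns, h.possible⟩

theorem IsLoop.append {a b : List (Fin N)} (ha : IsLoop g ν c a) (hb : IsLoop g ν c b) :
    IsLoop g ν c (a ++ b) := by
  refine Or.inr ⟨?_, ?_⟩
  · rw [wordMap_append, ha.wordMap_eq, hb.wordMap_eq]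
  · rw [wordWeight_append, ha.wordMap_eq]
    exact mul_ne_zero ha.wordWeight_ne_zero hb.wordWeight_ne_zero

/-- A nonempty loop begins with a cycle word, and what follows is a loop. -/
theorem IsLoop.exists_cycleWord_append {τ : List (Fin N)} (h : IsLoop g ν c τ) (hne : τ ≠ []) :
    ∃ β τ', IsCycleWord g ν c β ∧ IsLoop g ν c τ' ∧ τ = β ++ τ' := by
  classical
  -- The cycle word is the part of `τ` up to the first return to `c`.
  have hex : ∃ n, 0 < n ∧ wordMap g (τ.take n) c = c :=
    ⟨τ.length, List.length_pos_iff.2 hne, by simpa using h.wordMap_eq⟩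
  obtain ⟨hpos, hret⟩ := Nat.find_spec hex
  have hmin : ∀ m, m < Nat.find hex → ¬ (0 < m ∧ wordMap g (τ.take m) c = c) :=
    fun m hm => Nat.find_min hex hm
  generalize Nat.find hex = n at hpos hret hmin
  have hw := h.wordWeight_ne_zero
  have hm := h.wordMap_eq
  rw [← List.take_append_drop n τ] at hw hm
  rw [wordWeight_append, mul_ne_zero_iff, hret] at hw
  rw [wordMap_append, hret] at hm
  refine ⟨τ.take n, τ.drop n, ⟨?_, hret, ?_, hw.1⟩, Or.inr ⟨hm, hw.2⟩,
    (List.take_append_drop n τ).symm⟩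
  · simp [hne, hpos.ne']
  · intro γ hγ hγne hγβ hγc
    have hlen : γ.length < (τ.take n).length :=
      lt_of_le_of_ne hγ.length_le fun hl => hγβ (hγ.eq_of_length hl)
    have hγτ : γ = τ.take γ.length := List.prefix_iff_eq_take.1 (hγ.trans (List.take_prefix n τ))
    refine hmin γ.length (hlen.trans_le (List.length_take_le n τ))
      ⟨List.length_pos_iff.2 hγne, ?_⟩
    rw [← hγτ, hγc]

theorem IsLoop.exists_flatten {τ : List (Fin N)} (h : IsLoop g ν c τ) :
    ∃ βs : List (List (Fin N)), (∀ β ∈ βs, IsCycleWord g ν c β) ∧ τ = βs.flatten := by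
  induction hn : τ.length using Nat.strong_induction_on generalizing τ with
  | _ n ih =>
    by_cases hne : τ = []
    · exact ⟨[], by simp, by simp [hne]⟩
    · obtain ⟨β, τ', hβ, hτ', rfl⟩ := h.exists_cycleWord_append hne
      have hlen : τ'.length < n := by
        have := List.length_pos_iff.2 hβ.ne_nil
        rw [← hn, List.length_append]; omega
      obtain ⟨βs, hβs, rfl⟩ := ih _ hlen hτ' rfl
      exact ⟨β :: βs, by simpa using ⟨hβ, hβs⟩, by simp⟩

/-- Cycle words form a suffix code. -/
theorem IsCycleWord.eq_of_suffix
    (hinj : ∀ i c₁ c₂, ν i c₁ ≠ 0 → ν i c₂ ≠ 0 → g i c₁ = g i c₂ → c₁ = c₂)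
    {β β' : List (Fin N)} (h : IsCycleWord g ν c β) (h' : IsCycleWord g ν c β')
    (hs : β <:+ β') : β = β' := by
  obtain ⟨α, rfl⟩ := hs
  have hw := h'.possible
  have hm := h'.returns
  rw [wordWeight_append, mul_ne_zero_iff] at hw
  rw [wordMap_append] at hm
  -- `β` leads to `c` both from `c` and from the end of `α`; `α` would then be an early return.
  have hα : wordMap g α c = c :=
    wordMap_injective hinj β hw.2 h.possible (hm.trans h.returns.symm)
  by_contra hne
  refine h'.first α (List.prefix_append α β) ?_ ?_ hα
  · rintro rfl; exact hne rfl
  · intro h0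
    exact h.ne_nil (by simpa using h0)

theorem IsCycleWord.append_cancel
    (hinj : ∀ i c₁ c₂, ν i c₁ ≠ 0 → ν i c₂ ≠ 0 → g i c₁ = g i c₂ → c₁ = c₂)
    {a a' β β' : List (Fin N)} (h : IsCycleWord g ν c β) (h' : IsCycleWord g ν c β')
    (he : a ++ β = a' ++ β') : a = a' ∧ β = β' := by
  have hβ : β = β' := by
    rcases List.suffix_or_suffix_of_suffix (List.suffix_append a β)
      (he ▸ List.suffix_append a' β') with hs | hs
    · exact h.eq_of_suffix hinj h' hs
    · exact (h'.eq_of_suffix hinj h hs).symm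
  subst hβ
  exact ⟨List.append_cancel_right he, rfl⟩

theorem append_flatten_mem_wordsEnding {n : ℕ} {ω : List (Fin N)} {βs : List (List (Fin N))}
    (hω : ω ∈ wordsEnding g ν c n) (hβs : ∀ β ∈ βs, IsCycleWord g ν c β) :
    ω ++ βs.flatten ∈ wordsEnding g ν c (n + βs.length) := by
  obtain ⟨ω₀, h₀, αs, hlen, hαs, rfl⟩ := hω
  refine ⟨ω₀, h₀, αs ++ βs, by simp [hlen], ?_, by simp⟩
  intro β hβ
  rcases List.mem_append.1 hβ with hβ | hβ
  · exact hαs β hβ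
  · exact hβs β hβ

theorem exists_of_mem_wordsEnding_succ {n : ℕ} {ω : List (Fin N)}
    (hω : ω ∈ wordsEnding g ν c (n + 1)) :
    ∃ ω' ∈ wordsEnding g ν c n, ∃ β, IsCycleWord g ν c β ∧ ω = ω' ++ β := by
  obtain ⟨ω₀, h₀, αs, hlen, hαs, rfl⟩ := hω
  obtain rfl | ⟨αs, β, rfl⟩ := List.eq_nil_or_concat' αs
  · simp at hlen
  · refine ⟨ω₀ ++ αs.flatten, ⟨ω₀, h₀, αs, by simpa using hlen, ?_, rfl⟩, β, ?_, by simp⟩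
    · exact fun b hb => hαs b (by simp [hb])
    · exact hαs β (by simp)

/-- By the suffix code property, the last cycle word can be peeled off in only one way. -/
theorem wordsEnding_level_unique
    (hinj : ∀ i c₁ c₂, ν i c₁ ≠ 0 → ν i c₂ ≠ 0 → g i c₁ = g i c₂ → c₁ = c₂)
    {n m : ℕ} {ω : List (Fin N)} (hn : ω ∈ wordsEnding g ν c n) (hm : ω ∈ wordsEnding g ν c m) :
    n = m := by
  induction n generalizing m ω with
  | zero =>
    cases m with
    | zero => rfl
    | succ m =>
      rw [wordsEnding_zero] at hn
      obtain ⟨ω', -, β, hβ, rfl⟩ := exists_of_mem_wordsEnding_succ hm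
      exact absurd (List.suffix_append _ _) (hn β hβ)
  | succ n ih =>
    obtain ⟨ω', hω', β, hβ, rfl⟩ := exists_of_mem_wordsEnding_succ hn
    cases m with
    | zero =>
      rw [wordsEnding_zero] at hm
      exact absurd (List.suffix_append _ _) (hm β hβ)
    | succ m =>
      obtain ⟨ω'', hω'', β', hβ', he⟩ := exists_of_mem_wordsEnding_succ hm
      obtain ⟨rfl, rfl⟩ := hβ.append_cancel hinj hβ' he
      rw [ih hω' hω'']

theorem exists_loop_decomposition (ω : List (Fin N)) :
    ∃ ω₀ ∈ wordsZero g ν c, ∃ γ, IsLoop g ν c γ ∧ ω = ω₀ ++ γ := by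
  induction hn : ω.length using Nat.strong_induction_on generalizing ω with
  | _ n ih =>
    by_cases h : ω ∈ wordsZero g ν c
    · exact ⟨ω, h, [], Or.inl rfl, by simp⟩
    · simp only [wordsZero, Set.mem_ofPred_eq, not_forall, not_not] at h
      obtain ⟨β, hβ, ω', rfl⟩ := h
      have hlen : ω'.length < n := by
        have := List.length_pos_iff.2 hβ.ne_nil
        rw [← hn, List.length_append]; omega
      obtain ⟨ω₀, h₀, γ, hγ, rfl⟩ := ih _ hlen ω' rfl
      exact ⟨ω₀, h₀, γ ++ β, hγ.append hβ.isLoop, by simp⟩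

theorem nil_mem_wordsZero : [] ∈ wordsZero g ν c := fun _ hβ hs =>
  hβ.ne_nil (List.suffix_nil.1 hs)

theorem append_loop_notMem_wordsZero {ω τ : List (Fin N)} (hτ : IsLoop g ν c τ) (hne : τ ≠ []) :
    ω ++ τ ∉ wordsZero g ν c := by
  obtain ⟨βs, hβs, rfl⟩ := hτ.exists_flatten
  obtain rfl | ⟨αs, β, rfl⟩ := List.eq_nil_or_concat' βs
  · simp at hne
  · intro h
    exact h β (hβs β (by simp)) ⟨ω ++ αs.flatten, by simp⟩

theorem flatten_replicate_mem_wordsEnding {β : List (Fin N)} (hβ : IsCycleWord g ν c β) (n : ℕ) :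
    (List.replicate n β).flatten ∈ wordsEnding g ν c n :=
  ⟨[], nil_mem_wordsZero, List.replicate n β, by simp,
    fun b hb => List.eq_of_mem_replicate hb ▸ hβ, by simp⟩

end Words

/-! ### Word operators and closed spans -/

section Span

variable {N : ℕ} {H : Type*} [NormedAddCommGroup H] [InnerProductSpace ℂ H]
  {S : Fin N → H →L[ℂ] H}

theorem wordOp_cons (i : Fin N) (ω : List (Fin N)) (x : H) :
    wordOp S (i :: ω) x = S i (wordOp S ω x) := by
  simp [wordOp]

theorem wordOp_append (a b : List (Fin N)) (x : H) :
    wordOp S (a ++ b) x = wordOp S a (wordOp S b x) := by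
  simp [wordOp]

theorem mem_wordSpan (v : H) {A : Set (List (Fin N))} {ω : List (Fin N)} (h : ω ∈ A) :
    wordOp S ω v ∈ wordSpan S v A :=
  Submodule.le_topologicalClosure _ (Submodule.subset_span ⟨ω, h, rfl⟩)

theorem inner_eq_zero_of_mem_wordSpan {v x y : H} {A : Set (List (Fin N))}
    (h : ∀ ω ∈ A, inner ℂ x (wordOp S ω v) = 0) (hy : y ∈ wordSpan S v A) : inner ℂ x y = 0 := by
  have hle : wordSpan S v A ≤ (ℂ ∙ x)ᗮ := by
    refine Submodule.topologicalClosure_minimal _ (Submodule.span_le.2 ?_)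
      (Submodule.isClosed_orthogonal _)
    rintro _ ⟨ω, hω, rfl⟩
    exact Submodule.mem_orthogonal_singleton_iff_inner_right.2 (h ω hω)
  exact Submodule.mem_orthogonal_singleton_iff_inner_right.1 (hle hy)

end Span

/-! ### Inner products of word vectors and incompleteness -/

section Inner

variable {N : ℕ} {H M : Type*} [NormedAddCommGroup H] [InnerProductSpace ℂ H] [CompleteSpace H]
  {S : Fin N → H →L[ℂ] H} {E : M → H} {g : Fin N → M → M} {ν : Fin N → M → ℂ}

theorem IsCuntzFamily.inner_apply (hS : IsCuntzFamily S) (i : Fin N) (x y : H) :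
    inner ℂ (S i x) (S i y) = inner ℂ x y := by
  rw [← ContinuousLinearMap.adjoint_inner_right, ← ContinuousLinearMap.comp_apply, hS.isometry]
  rfl

theorem IsCuntzFamily.inner_apply_of_ne (hS : IsCuntzFamily S) {i j : Fin N} (h : i ≠ j)
    (x y : H) : inner ℂ (S i x) (S j y) = 0 := by
  rw [← ContinuousLinearMap.adjoint_inner_right, ← ContinuousLinearMap.comp_apply,
    hS.orthogonal i j h]
  simp

theorem IsCuntzFamily.inner_wordOp (hS : IsCuntzFamily S) (ω : List (Fin N)) (x y : H) :
    inner ℂ (wordOp S ω x) (wordOp S ω y) = inner ℂ x y := by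
  induction ω with
  | nil => simp [wordOp]
  | cons i ω ih => rw [wordOp_cons, wordOp_cons, hS.inner_apply, ih]

theorem IsCuntzFamily.norm_wordOp (hS : IsCuntzFamily S) (ω : List (Fin N)) (x : H) :
    ‖wordOp S ω x‖ = ‖x‖ := by
  rw [@norm_eq_sqrt_re_inner ℂ, @norm_eq_sqrt_re_inner ℂ, hS.inner_wordOp]

/-- Moving each letter to the left slot as `S_i^*` walks `E c` along `τ`; the weights come out
conjugated. -/
theorem inner_wordOp_right (hE : ∀ i c, ((S i)†) (E c) = ν i c • E (g i c))
    (τ : List (Fin N)) (c : M) (v : H) :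
    inner ℂ (E c) (wordOp S τ v) =
      conj (wordWeight g ν τ c) * inner ℂ (E (wordMap g τ c)) v := by
  induction τ generalizing c with
  | nil => simp [wordOp, wordWeight, wordMap]
  | cons i τ ih =>
    rw [wordOp_cons, ← ContinuousLinearMap.adjoint_inner_left, hE, inner_smul_left, ih]
    simp [wordWeight, wordMap, mul_assoc]

theorem isLoop_of_inner_ne_zero (hEo : Orthonormal ℂ E)
    (hE : ∀ i c, ((S i)†) (E c) = ν i c • E (g i c)) {c : M} {τ : List (Fin N)}
    (h : inner ℂ (E c) (wordOp S τ (E c)) ≠ 0) : IsLoop g ν c τ := by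
  rw [inner_wordOp_right hE, mul_ne_zero_iff] at h
  refine Or.inr ⟨?_, fun h0 => h.1 (by simp [h0])⟩
  by_contra hne
  exact h.2 (hEo.2 hne)

theorem inner_wordOp_of_isLoop (hEo : Orthonormal ℂ E)
    (hE : ∀ i c, ((S i)†) (E c) = ν i c • E (g i c)) {c : M} {τ : List (Fin N)}
    (h : IsLoop g ν c τ) : inner ℂ (E c) (wordOp S τ (E c)) = conj (wordWeight g ν τ c) := by
  rw [inner_wordOp_right hE, h.wordMap_eq, inner_self_eq_norm_sq_to_K, hEo.1]
  simp

/-- Equal first letters cancel and distinct ones give orthogonal ranges, so one word must be a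
prefix of the other. -/
theorem exists_loop_of_inner_ne_zero (hS : IsCuntzFamily S) (hEo : Orthonormal ℂ E)
    (hE : ∀ i c, ((S i)†) (E c) = ν i c • E (g i c)) {c : M} {ω ω' : List (Fin N)}
    (h : inner ℂ (wordOp S ω (E c)) (wordOp S ω' (E c)) ≠ 0) :
    ∃ τ, IsLoop g ν c τ ∧ (ω' = ω ++ τ ∨ ω = ω' ++ τ) := by
  induction ω generalizing ω' with
  | nil =>
    exact ⟨ω', isLoop_of_inner_ne_zero hEo hE (by simpa [wordOp] using h), Or.inl (by simp)⟩
  | cons i ω ih =>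
    cases ω' with
    | nil =>
      refine ⟨i :: ω, isLoop_of_inner_ne_zero (S := S) hEo hE fun h0 => h ?_, Or.inr (by simp)⟩
      exact inner_eq_zero_symm.1 (by simpa [wordOp] using h0)
    | cons j ω' =>
      rw [wordOp_cons, wordOp_cons] at h
      by_cases hij : i = j
      · subst hij
        rw [hS.inner_apply] at h
        obtain ⟨τ, hτ, hor⟩ := ih h
        exact ⟨τ, hτ, by simpa using hor⟩
      · exact absurd (hS.inner_apply_of_ne hij _ _) h

theorem orthonormal_wordsZero (hS : IsCuntzFamily S) (hEo : Orthonormal ℂ E)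
    (hE : ∀ i c, ((S i)†) (E c) = ν i c • E (g i c)) (c : M) :
    Orthonormal ℂ (fun ω : wordsZero g ν c => wordOp S (ω : List (Fin N)) (E c)) := by
  refine ⟨fun ω => (hS.norm_wordOp _ _).trans (hEo.1 c), ?_⟩
  rintro ⟨ω, hω⟩ ⟨ω', hω'⟩ hne
  by_contra h
  obtain ⟨τ, hτ, rfl | rfl⟩ := exists_loop_of_inner_ne_zero hS hEo hE h
  · exact append_loop_notMem_wordsZero hτ (by rintro rfl; simp at hne) hω'
  · exact append_loop_notMem_wordsZero hτ (by rintro rfl; simp at hne) hω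

/-- This is `∑ ‖S_i^* e_c‖² = ‖e_c‖²`, from `∑ S_i S_i^* = I`. -/
theorem sum_norm_sq_eq_one (hS : IsCuntzFamily S) (hEo : Orthonormal ℂ E)
    (hE : ∀ i c, ((S i)†) (E c) = ν i c • E (g i c)) (c : M) : ∑ i, ‖ν i c‖ ^ 2 = 1 := by
  have h : inner ℂ (E c) ((∑ i, S i ∘L (S i)†) (E c)) = ((∑ i, ‖ν i c‖ ^ 2 : ℝ) : ℂ) := by
    rw [sum_apply, inner_sum, Complex.ofReal_sum]
    refine Finset.sum_congr rfl fun i _ => ?_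
    rw [ContinuousLinearMap.comp_apply, ← ContinuousLinearMap.adjoint_inner_left,
      inner_self_eq_norm_sq_to_K, hE, norm_smul, hEo.1]
    simp
  rw [hS.sum_eq, ContinuousLinearMap.id_apply, inner_self_eq_norm_sq_to_K, hEo.1] at h
  have h' : ((∑ i, ‖ν i c‖ ^ 2 : ℝ) : ℂ) = ((1 : ℝ) : ℂ) := by rw [← h]; simp
  exact Complex.ofReal_injective h'

theorem norm_le_one_of_sum (hsum : ∀ c, ∑ i, ‖ν i c‖ ^ 2 = 1) (i : Fin N) (c : M) :
    ‖ν i c‖ ≤ 1 := by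
  have h := Finset.single_le_sum (f := fun i => ‖ν i c‖ ^ 2) (fun j _ => sq_nonneg _)
    (Finset.mem_univ i)
  rw [hsum c] at h
  exact (sq_le_one_iff₀ (norm_nonneg _)).1 h

theorem norm_lt_one_of_sum (hsum : ∀ c, ∑ i, ‖ν i c‖ ^ 2 = 1) {i j : Fin N} {c : M}
    (hij : i ≠ j) (hj : ν j c ≠ 0) : ‖ν i c‖ < 1 := by
  have h := Finset.add_le_sum (f := fun i => ‖ν i c‖ ^ 2) (fun j _ => sq_nonneg _)
    (Finset.mem_univ i) (Finset.mem_univ j) hij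
  rw [hsum c] at h
  have : 0 < ‖ν j c‖ ^ 2 := by positivity
  exact (sq_lt_one_iff₀ (norm_nonneg _)).1 (by linarith)

theorem norm_wordWeight_le_one (hsum : ∀ c, ∑ i, ‖ν i c‖ ^ 2 = 1) (τ : List (Fin N)) (c : M) :
    ‖wordWeight g ν τ c‖ ≤ 1 := by
  induction τ generalizing c with
  | nil => simp [wordWeight]
  | cons i τ ih =>
    rw [wordWeight, norm_mul]
    exact mul_le_one₀ (norm_le_one_of_sum hsum i c) (norm_nonneg _) (ih _)

theorem norm_wordWeight_lt_one (hsum : ∀ c, ∑ i, ‖ν i c‖ ^ 2 = 1) {c : M}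
    (h : ∃ i j, i ≠ j ∧ ν i c ≠ 0 ∧ ν j c ≠ 0) {τ : List (Fin N)} (hτ : τ ≠ []) :
    ‖wordWeight g ν τ c‖ < 1 := by
  obtain ⟨i, j, hij, hi, hj⟩ := h
  cases τ with
  | nil => exact absurd rfl hτ
  | cons k τ =>
    rw [wordWeight, norm_mul]
    -- Any first letter `k` differs from `i` or `j`, so it leaves mass for another edge.
    have hk : ‖ν k c‖ < 1 := by
      by_cases hki : k = i
      · exact norm_lt_one_of_sum hsum (hki ▸ hij) hj
      · exact norm_lt_one_of_sum hsum hki hi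
    exact mul_lt_one_of_nonneg_of_lt_one_left (norm_nonneg _) hk
      (norm_wordWeight_le_one hsum τ _)

theorem IsIrreducibleWalk.exists_cycleWord (hirr : IsIrreducibleWalk g ν) {c : M} {i : Fin N}
    (hi : ν i c ≠ 0) : ∃ β, IsCycleWord g ν c β := by
  obtain ⟨ω, hω, hw⟩ := hirr (g i c) c
  have : IsLoop g ν c (i :: ω) := Or.inr ⟨hω, mul_ne_zero hi hw⟩
  obtain ⟨β, -, hβ, -⟩ := this.exists_cycleWord_append (by simp)
  exact ⟨β, hβ⟩

theorem wordSpan_wordsEnding_ne (hS : IsCuntzFamily S) (hEo : Orthonormal ℂ E)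
    (hE : ∀ i c, ((S i)†) (E c) = ν i c • E (g i c))
    (hinj : ∀ i c₁ c₂, ν i c₁ ≠ 0 → ν i c₂ ≠ 0 → g i c₁ = g i c₂ → c₁ = c₂)
    (hirr : IsIrreducibleWalk g ν) {c : M} (hc : ∃ i j, i ≠ j ∧ ν i c ≠ 0 ∧ ν j c ≠ 0) (n : ℕ) :
    wordSpan S (E c) (wordsEnding g ν c n) ≠ wordSpan S (E c) Set.univ := by
  have hsum := sum_norm_sq_eq_one hS hEo hE
  obtain ⟨β, hβ⟩ : ∃ β, IsCycleWord g ν c β := by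
    obtain ⟨i, -, -, hi, -⟩ := hc
    exact hirr.exists_cycleWord hi
  set z : ℂ := conj (wordWeight g ν β c) with hz
  have hz1 : ‖z‖ < 1 := by
    rw [hz, RCLike.norm_conj]
    exact norm_wordWeight_lt_one hsum hc hβ.ne_nil
  set b := (List.replicate n β).flatten with hb
  have hbn : b ∈ wordsEnding g ν c n := flatten_replicate_mem_wordsEnding hβ n
  have hbs : b ++ β ∈ wordsEnding g ν c (n + 1) := by
    simpa using append_flatten_mem_wordsEnding (βs := [β]) hbn (by simpa using hβ)
  -- This is `S_b` applied to `S_β e_c` minus its projection onto `e_c`.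
  set x : H := wordOp S (b ++ β) (E c) - z • wordOp S b (E c) with hx
  have horth : ∀ ω ∈ wordsEnding g ν c n, inner ℂ x (wordOp S ω (E c)) = 0 := by
    intro ω hω
    rw [← inner_conj_symm, map_eq_zero, hx, inner_sub_right, inner_smul_right]
    by_cases hωb : ω = b
    · rw [hωb, wordOp_append, hS.inner_wordOp, hS.inner_wordOp,
        inner_wordOp_of_isLoop hEo hE hβ.isLoop, inner_self_eq_norm_sq_to_K, hEo.1]
      simp [hz]
    · have h1 : inner ℂ (wordOp S ω (E c)) (wordOp S (b ++ β) (E c)) = 0 := by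
        by_contra h
        obtain ⟨τ, hτ, he⟩ := exists_loop_of_inner_ne_zero hS hEo hE h
        obtain ⟨βs, hβs, rfl⟩ := hτ.exists_flatten
        rcases he with he | he
        -- Levels differ by one, so `τ` is a single cycle word, and cancelling it would give `ω =
        -- b`.
        · have hm := append_flatten_mem_wordsEnding hω hβs
          have hl := wordsEnding_level_unique hinj (he ▸ hm) hbs
          obtain ⟨α, rfl⟩ := List.length_eq_one_iff.1 (by omega : βs.length = 1)
          have hα : IsCycleWord g ν c α := hβs α (by simp)
          exact hωb (hβ.append_cancel hinj hα (by simpa using he)).1.symm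
        -- Here `ω` would have level at least `n + 1`.
        · have hm := append_flatten_mem_wordsEnding hbs hβs
          have hl := wordsEnding_level_unique hinj hω (he ▸ hm)
          omega
      have h2 : inner ℂ (wordOp S ω (E c)) (wordOp S b (E c)) = 0 := by
        by_contra h
        obtain ⟨τ, hτ, he⟩ := exists_loop_of_inner_ne_zero hS hEo hE h
        obtain ⟨βs, hβs, rfl⟩ := hτ.exists_flatten
        rcases he with he | he
        · have hm := append_flatten_mem_wordsEnding hω hβs
          have hl := wordsEnding_level_unique hinj (he ▸ hm) hbn
          obtain rfl := List.length_eq_zero_iff.1 (by omega : βs.length = 0)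
          exact hωb (by simpa using he.symm)
        · have hm := append_flatten_mem_wordsEnding hbn hβs
          have hl := wordsEnding_level_unique hinj hω (he ▸ hm)
          obtain rfl := List.length_eq_zero_iff.1 (by omega : βs.length = 0)
          exact hωb (by simpa using he)
      rw [h1, h2]; simp
  intro heq
  have hmem : x ∈ wordSpan S (E c) (wordsEnding g ν c n) := by
    rw [heq]
    exact Submodule.sub_mem _ (mem_wordSpan _ (Set.mem_univ _))
      (Submodule.smul_mem _ _ (mem_wordSpan _ (Set.mem_univ _)))
  -- `x` would be orthogonal to itself; comparing norms then gives `1 = ‖z‖`.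
  have hx0 : x = 0 := inner_self_eq_zero.1 (inner_eq_zero_of_mem_wordSpan horth hmem)
  have hnorm := congrArg norm (sub_eq_zero.1 hx0)
  rw [norm_smul, hS.norm_wordOp, hS.norm_wordOp, hEo.1] at hnorm
  linarith

/-! ### Weights of modulus 0 or 1 -/

section Deterministic

theorem existsUnique_ne_zero (hsum : ∀ c, ∑ i, ‖ν i c‖ ^ 2 = 1)
    (h01 : ∀ c i, ‖ν i c‖ = 0 ∨ ‖ν i c‖ = 1) (c : M) : ∃ d, ∀ i, ν i c ≠ 0 ↔ i = d := by
  obtain ⟨d, hd⟩ : ∃ d, ν d c ≠ 0 := by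
    by_contra! h
    have := hsum c
    simp [h] at this
  refine ⟨d, fun i => ⟨fun hi => ?_, fun h => h ▸ hd⟩⟩
  by_contra hne
  rcases h01 c i with h | h
  · exact hi (norm_eq_zero.1 h)
  · exact (norm_lt_one_of_sum hsum hne hd).ne h

theorem norm_wordWeight_eq_one (h01 : ∀ c i, ‖ν i c‖ = 0 ∨ ‖ν i c‖ = 1) {τ : List (Fin N)} {c : M}
    (h : wordWeight g ν τ c ≠ 0) : ‖wordWeight g ν τ c‖ = 1 := by
  induction τ generalizing c with
  | nil => simp [wordWeight]
  | cons i τ ih =>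
    simp only [wordWeight, mul_ne_zero_iff] at h
    rw [wordWeight, norm_mul, ih h.2, mul_one]
    exact (h01 c i).resolve_left (norm_ne_zero_iff.2 h.1)

/-- Following the only possible edge is a map `f`. Irreducibility makes it surjective, hence a
permutation of the finite set `M`, with a single orbit; its period is the cycle length. -/
theorem isSingleCycle_of_existsUnique [Finite M] [Nonempty M] (hirr : IsIrreducibleWalk g ν)
    (hd : ∀ c, ∃ d, ∀ i, ν i c ≠ 0 ↔ i = d) : IsSingleCycle g ν := by
  choose d hd using hd
  set f : M → M := fun c => g (d c) c with hf
  have hiter : ∀ (ω : List (Fin N)) (c : M), wordWeight g ν ω c ≠ 0 →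
      wordMap g ω c = f^[ω.length] c := by
    intro ω
    induction ω with
    | nil => intro c _; rfl
    | cons i ω ih =>
      intro c h
      simp only [wordWeight, mul_ne_zero_iff] at h
      obtain rfl := (hd c i).1 h.1
      exact ih _ h.2
  have hreach : ∀ c₁ c₂, ∃ n, f^[n] c₁ = c₂ := fun c₁ c₂ => by
    obtain ⟨ω, hω, hw⟩ := hirr c₁ c₂
    exact ⟨ω.length, (hiter ω c₁ hw).symm.trans hω⟩
  have hsurj : Function.Surjective f := fun c => by
    obtain ⟨n, hn⟩ := hreach (f c) c
    exact ⟨f^[n] c, by rw [← Function.iterate_succ_apply' f, Function.iterate_succ_apply, hn]⟩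
  let σ : Equiv.Perm M := Equiv.ofBijective f (Finite.injective_iff_bijective.1
    (Finite.injective_iff_surjective.2 hsurj))
  have hσ : ∀ n c, (σ ^ n) c = f^[n] c := fun n c => by
    rw [Equiv.Perm.coe_pow]; rfl
  let x₀ : M := Classical.arbitrary M
  have hmem : ∀ c, c ∈ MulAction.orbit (Subgroup.zpowers σ) x₀ := fun c => by
    obtain ⟨n, hn⟩ := hreach x₀ c
    exact ⟨⟨σ ^ n, n, by simp⟩, (hσ n x₀).trans hn⟩
  let x : ZMod (Function.minimalPeriod (σ • ·) x₀) ≃ M :=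
    (MulAction.orbitZPowersEquiv σ x₀).symm.trans (Equiv.subtypeUnivEquiv hmem)
  have hx : ∀ k : ℤ, x k = (σ ^ k) x₀ := fun k => by
    change ((MulAction.orbitZPowersEquiv σ x₀).symm k : M) = _
    rw [MulAction.orbitZPowersEquiv_symm_apply']
    rfl
  refine ⟨Function.minimalPeriod (σ • ·) x₀, ?_, x, fun k => d (x k), fun k => ⟨hd _, ?_⟩⟩
  -- Starting from `f x₀` guarantees a positive return time `n + 1`, even when `n = 0`.
  · obtain ⟨n, hn⟩ := hreach (f x₀) x₀
    refine Function.IsPeriodicPt.minimalPeriod_pos (n := n + 1) n.succ_pos ?_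
    change f^[n + 1] x₀ = x₀
    rw [Function.iterate_succ_apply, hn]
  · obtain ⟨m, rfl⟩ := ZMod.intCast_surjective k
    have h1 : x ((m : ZMod _) + 1) = x ((m + 1 : ℤ) : ZMod _) := by push_cast; rfl
    rw [h1, hx (m + 1), add_comm m 1, zpow_add, zpow_one, Equiv.Perm.mul_apply, ← hx]
    rfl

/-- Equality case of Cauchy–Schwarz: two unit vectors with unimodular inner product. The proof
expands the squared norm of the difference. -/
theorem wordOp_eq_smul_of_isLoop (hS : IsCuntzFamily S) (hEo : Orthonormal ℂ E)
    (hE : ∀ i c, ((S i)†) (E c) = ν i c • E (g i c))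
    (h01 : ∀ c i, ‖ν i c‖ = 0 ∨ ‖ν i c‖ = 1) {c : M} {γ : List (Fin N)} (hγ : IsLoop g ν c γ) :
    wordOp S γ (E c) = conj (wordWeight g ν γ c) • E c := by
  have hw := norm_wordWeight_eq_one h01 hγ.wordWeight_ne_zero
  have hin := inner_wordOp_of_isLoop (S := S) hEo hE hγ
  have hin' : inner ℂ (wordOp S γ (E c)) (E c) = wordWeight g ν γ c := by
    rw [← inner_conj_symm, hin, Complex.conj_conj]
  have hmul : wordWeight g ν γ c * conj (wordWeight g ν γ c) = 1 := by
    rw [RCLike.mul_conj, hw]; simp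
  rw [← sub_eq_zero, ← inner_self_eq_zero (𝕜 := ℂ), inner_sub_left, inner_sub_right,
    inner_sub_right, inner_smul_left, inner_smul_left, inner_smul_right, inner_smul_right, hin,
    hin', hS.inner_wordOp, inner_self_eq_norm_sq_to_K, hEo.1, Complex.conj_conj, mul_comm (conj _),
    hmul]
  simp [hmul]

theorem wordSpan_wordsZero_eq (hS : IsCuntzFamily S) (hEo : Orthonormal ℂ E)
    (hE : ∀ i c, ((S i)†) (E c) = ν i c • E (g i c))
    (h01 : ∀ c i, ‖ν i c‖ = 0 ∨ ‖ν i c‖ = 1) (c : M) :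
    wordSpan S (E c) (wordsZero g ν c) = wordSpan S (E c) Set.univ := by
  apply le_antisymm
  · exact Submodule.topologicalClosure_mono
      (Submodule.span_mono (Set.image_mono (Set.subset_univ _)))
  · refine Submodule.topologicalClosure_mono (Submodule.span_le.2 ?_)
    rintro _ ⟨ω, -, rfl⟩
    obtain ⟨ω₀, h₀, γ, hγ, rfl⟩ := exists_loop_decomposition (g := g) (ν := ν) (c := c) ω
    simp only [wordOp_append, wordOp_eq_smul_of_isLoop hS hEo hE h01 hγ, map_smul]
    exact Submodule.smul_mem _ _ (Submodule.subset_span ⟨ω₀, h₀, rfl⟩)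

end Deterministic

end Inner

/-! ### The reversing property -/

section Reversing

variable {N : ℕ} {K M : Type*} [NormedAddCommGroup K] [InnerProductSpace ℂ K] [CompleteSpace K]
  [Fintype M] {V : Fin N → K →L[ℂ] K} {K₀ : Submodule ℂ K} {e : OrthonormalBasis M ℂ K₀}
  {g : Fin N → M → M} {ν : Fin N → M → ℂ}

/-- Only one term of `∑ V_j V_j^* e_c = e_c` survives, and its coefficient is unimodular. -/
theorem isReversing_of_existsUnique (hV : IsRowCoisometry V) (hwalk : ActsAsRandomWalk V K₀ e g ν)
    (h01 : ∀ c i, ‖ν i c‖ = 0 ∨ ‖ν i c‖ = 1) (hd : ∀ c, ∃ d, ∀ i, ν i c ≠ 0 ↔ i = d) :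
    IsReversing V e g ν := by
  intro i c hi
  obtain ⟨d, hd⟩ := hd c
  obtain rfl := (hd i).1 hi
  have h : (∑ j, V j ∘L (V j)†) (e c : K) = ν i c • V i (e (g i c) : K) := by
    rw [sum_apply, Finset.sum_eq_single i]
    · rw [ContinuousLinearMap.comp_apply, hwalk.adjoint_apply, map_smul]
    · intro j _ hj
      have hj0 : ν j c = 0 := by
        by_contra h0
        exact hj ((hd j).1 h0)
      rw [ContinuousLinearMap.comp_apply, hwalk.adjoint_apply, hj0, zero_smul, map_zero]
    · simp
  rw [hV.sum_eq, ContinuousLinearMap.id_apply] at h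
  have h1 : ‖ν i c‖ = 1 := (h01 c i).resolve_left (norm_ne_zero_iff.2 hi)
  rw [h, smul_smul, RCLike.conj_mul, h1]
  simp

end Reversing

end CuntzWalk

theorem proposition3p8 {N : ℕ} {K H M : Type*}
    [NormedAddCommGroup K] [InnerProductSpace ℂ K] [CompleteSpace K]
    [NormedAddCommGroup H] [InnerProductSpace ℂ H] [CompleteSpace H]
    [Fintype M] [Nonempty M]
    (V : Fin N → K →L[ℂ] K) (hV : CuntzWalk.IsRowCoisometry V)
    (ι : K →ₗᵢ[ℂ] H) (S : Fin N → H →L[ℂ] H) (hS : CuntzWalk.IsCuntzDilation V ι S)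
    (K₀ : Submodule ℂ K) [CompleteSpace K₀] (e : OrthonormalBasis M ℂ K₀)
    (g : Fin N → M → M) (ν : Fin N → M → ℂ)
    (hwalk : CuntzWalk.ActsAsRandomWalk V K₀ e g ν)
    (hirr : CuntzWalk.IsIrreducibleWalk g ν)
    (hsimple : CuntzWalk.IsSimpleOn V K₀) :
    ((∀ c i, ‖ν i c‖ = 0 ∨ ‖ν i c‖ = 1) →
      CuntzWalk.IsSingleCycle g ν ∧
      CuntzWalk.IsReversing V e g ν ∧
      (∀ (c : M) (n : ℕ) (ω₀ γ : List (Fin N)), ω₀ ∈ CuntzWalk.wordsZero g ν c →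
        CuntzWalk.IsLoop g ν c γ → ω₀ ++ γ ∈ CuntzWalk.wordsEnding g ν c n →
        ∃ z : ℂ, ‖z‖ = 1 ∧
          CuntzWalk.wordOp S (ω₀ ++ γ) (ι (e c)) = z • CuntzWalk.wordOp S ω₀ (ι (e c))) ∧
      (∀ c : M,
        Orthonormal ℂ
          (fun ω : CuntzWalk.wordsZero g ν c => CuntzWalk.wordOp S (ω : List (Fin N)) (ι (e c))) ∧
        CuntzWalk.wordSpan S (ι (e c)) (CuntzWalk.wordsZero g ν c) =
          CuntzWalk.wordSpan S (ι (e c)) Set.univ)) ∧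
    (∀ c : M, (∃ i j, i ≠ j ∧ ν i c ≠ 0 ∧ ν j c ≠ 0) →
      ∀ n : ℕ, CuntzWalk.wordSpan S (ι (e c)) (CuntzWalk.wordsEnding g ν c n) ≠
        CuntzWalk.wordSpan S (ι (e c)) Set.univ) := by
  -- The embedded vectors stay orthonormal, and `S_i^*` acts on them by the same walk.
  have hEo : Orthonormal ℂ (fun c => ι (e c : K)) :=
    (e.orthonormal.comp_linearIsometry K₀.subtypeₗᵢ).comp_linearIsometry ι
  have hE : ∀ i c, (ContinuousLinearMap.adjoint (S i)) (ι (e c : K)) =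
      ν i c • ι (e (g i c) : K) := fun i c => by
    rw [hS.adjoint_apply, hwalk.adjoint_apply, map_smul]
  have hsum := CuntzWalk.sum_norm_sq_eq_one hS.cuntz hEo hE
  refine ⟨fun h01 => ?_, fun c hc n => CuntzWalk.wordSpan_wordsEnding_ne hS.cuntz hEo hE
    hwalk.injective hirr hc n⟩
  have hd := CuntzWalk.existsUnique_ne_zero hsum h01
  refine ⟨CuntzWalk.isSingleCycle_of_existsUnique hirr hd,
    CuntzWalk.isReversing_of_existsUnique hV hwalk h01 hd, ?_, fun c =>
    ⟨CuntzWalk.orthonormal_wordsZero hS.cuntz hEo hE c,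
      CuntzWalk.wordSpan_wordsZero_eq hS.cuntz hEo hE h01 c⟩⟩
  intro c n ω₀ γ _ hγ _
  refine ⟨starRingEnd ℂ (CuntzWalk.wordWeight g ν γ c), ?_, ?_⟩
  · rw [RCLike.norm_conj]
    exact CuntzWalk.norm_wordWeight_eq_one h01 hγ.wordWeight_ne_zero
  · rw [CuntzWalk.wordOp_append, CuntzWalk.wordOp_eq_smul_of_isLoop hS.cuntz hEo hE h01 hγ,
      map_smul]
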